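/- Let $(X,\mu)$ be a finite measure space and let $K:\mathbb R\times X\to[0,\infty)$ be integrable on $\mathbb R\times X$ (with respect to $ds\,d\mu$) with $\int_{\mathbb R}K(s,\tau)\,ds>0$ for all $\tau\in X$. Let $g:[0,\infty)\times X\to[0,\infty)$ be measurable, with $g(0,\tau)=0$, $g(\cdot,\tau)$ continuous, and with a finite derivative $g'(0,\tau)>0$ at $0$, for every $\tau\in X$. Consider measurable solutions $\phi:\mathbb R\to[0,\infty)$ of $$\phi(t)=\int_X d\mu(\tau)\int_{\mathbb R}K(s,\tau)\,g(\phi(t-s),\tau)\,ds,\qquad t\in\mathbb R, \tag{17}$$ and the characteristic function $$\chi(z)=1-\int_X\int_{\mathbb R}K(s,\tau)\,g'(0,\tau)\,e^{-sz}\,ds\,d\mu(\tau),$$ which is defined at those real $z$ for which the integral converges. Assume that $\chi(0)<0$ and that (C) for each $\delta>0$ there is a measurable $C_\delta:X\to[0,\infty)$ such that $g(u,\tau)\le C_\delta(\tau)u$ for all $u\in[0,\delta]$, $\tau\in X$, and $\int_X C_\delta(\tau)\,d\mu(\tau)\int_{\mathbb R}K(s,\tau)\,ds<+\infty$; (P)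 a bounded solution $\phi\ge 0$ of (17) vanishes at some point only if $\phi\equiv 0$. Then: 1. If $\chi$ has no positive zero, then every positive bounded solution $\phi$ of (17) satisfies $\liminf_{t\to-\infty}\phi(t)>0$. 2. If $\chi$ has no negative zero, then every positive bounded solution $\phi$ of (17) satisfies $\liminf_{t\to+\infty}\phi(t)>0$. 3. Equation (17) has no positive pulse solution, that is, no solution $\phi$ with $\phi(t)>0$ for all $t\in\mathbb R$ and $\phi(-\infty)=\phi(+\infty)=0$. -/

import Mathlib

open MeasureTheory Filter Topology Set

noncomputable section

namespace ConvEq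

variable {X : Type*} [MeasurableSpace X]

/-- The derivative `g'(0, τ)` of `u ↦ g u τ` at `0`, relative to the half-line `[0, ∞)`. -/
def slope0 (g : ℝ → X → ℝ) (τ : X) : ℝ :=
  derivWithin (fun u => g u τ) (Ici 0) 0

/-- The basic assumptions on the kernel `K` and the nonlinearity `g`. The function `g` matters
on `[0, ∞) × X` only: no condition is put on its values `g u τ` with `u < 0`. -/
structure Data (μ : Measure X) (K : ℝ → X → ℝ) (g : ℝ → X → ℝ) : Prop where
  K_nonneg : ∀ s τ, 0 ≤ K s τ
  K_integrable : Integrable (fun p : ℝ × X => K p.1 p.2) (volume.prod μ)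
  K_pos : ∀ τ, 0 < ∫⁻ s, ENNReal.ofReal (K s τ)
  g_nonneg : ∀ u τ, 0 ≤ u → 0 ≤ g u τ
  g_measurable : Measurable (fun p : ↥(Ici (0 : ℝ)) × X => g p.1 p.2)
  g_zero : ∀ τ, g 0 τ = 0
  g_continuous : ∀ τ, ContinuousOn (fun u => g u τ) (Ici 0)
  g_differentiable : ∀ τ, DifferentiableWithinAt ℝ (fun u => g u τ) (Ici 0) 0
  g_slope_pos : ∀ τ, 0 < slope0 g τ

/-- `φ : ℝ → [0, ∞)` is a (measurable) solution of
`φ(t) = ∫_X dμ(τ) ∫_ℝ K(s, τ) g(φ(t - s), τ) ds`, `t ∈ ℝ`; the integral is required to converge. -/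
structure IsSolution (μ : Measure X) (K : ℝ → X → ℝ) (g : ℝ → X → ℝ) (φ : ℝ → ℝ) : Prop where
  measurable : Measurable φ
  nonneg : ∀ t, 0 ≤ φ t
  integrable : ∀ t,
    Integrable (fun p : ℝ × X => K p.1 p.2 * g (φ (t - p.1)) p.2) (volume.prod μ)
  equation : ∀ t, φ t = ∫ τ, (∫ s, K s τ * g (φ (t - s)) τ) ∂μ

/-- A nonnegative function is bounded. -/
def IsBdd (φ : ℝ → ℝ) : Prop := ∃ B : ℝ, ∀ t, φ t ≤ B

/-- The integrand `K(s, τ) g'(0, τ) e^{-sz}` of the characteristic function. -/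
def charIntegrand (K : ℝ → X → ℝ) (g : ℝ → X → ℝ) (z : ℝ) (p : ℝ × X) : ℝ :=
  K p.1 p.2 * slope0 g p.2 * Real.exp (-(p.1 * z))

/-- `χ(z)` is well defined: the integral in its definition converges. -/
def CharDefined (μ : Measure X) (K : ℝ → X → ℝ) (g : ℝ → X → ℝ) (z : ℝ) : Prop :=
  Integrable (charIntegrand K g z) (volume.prod μ)

/-- The characteristic function `χ(z) = 1 - ∫_X ∫_ℝ K(s, τ) g'(0, τ) e^{-sz} ds dμ(τ)`,
meaningful at the points `z` with `CharDefined μ K g z`. -/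
def char (μ : Measure X) (K : ℝ → X → ℝ) (g : ℝ → X → ℝ) (z : ℝ) : ℝ :=
  1 - ∫ p, charIntegrand K g z p ∂(volume.prod μ)

/-- `z` is a (real) zero of `χ`. -/
def IsCharZero (μ : Measure X) (K : ℝ → X → ℝ) (g : ℝ → X → ℝ) (z : ℝ) : Prop :=
  CharDefined μ K g z ∧ char μ K g z = 0

/-- Condition (C): for each `δ > 0` there is a measurable `C_δ ≥ 0` with `g(u, τ) ≤ C_δ(τ) u` for
`u ∈ [0, δ]` and `∫_X C_δ(τ) dμ(τ) ∫_ℝ K(s, τ) ds < ∞`. -/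
def CondC (μ : Measure X) (K : ℝ → X → ℝ) (g : ℝ → X → ℝ) : Prop :=
  ∀ δ : ℝ, 0 < δ → ∃ C : X → ℝ, Measurable C ∧ (∀ τ, 0 ≤ C τ) ∧
    (∀ u τ, u ∈ Icc 0 δ → g u τ ≤ C τ * u) ∧
    Integrable (fun p : ℝ × X => C p.2 * K p.1 p.2) (volume.prod μ)

/-- Condition (P): a bounded nonnegative solution that vanishes at some point is identically
zero. -/
def CondP (μ : Measure X) (K : ℝ → X → ℝ) (g : ℝ → X → ℝ) : Prop :=
  ∀ φ : ℝ → ℝ, IsSolution μ K g φ → IsBdd φ → (∃ t, φ t = 0) → ∀ t, φ t = 0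

/-- A positive pulse solution. -/
def IsPositivePulse (μ : Measure X) (K : ℝ → X → ℝ) (g : ℝ → X → ℝ) (φ : ℝ → ℝ) : Prop :=
  IsSolution μ K g φ ∧ (∀ t, 0 < φ t) ∧ Tendsto φ atBot (𝓝 0) ∧ Tendsto φ atTop (𝓝 0)

end ConvEq

end

/-! Suppose a positive bounded solution `φ` has liminf zero at `-∞`. Minimizing over `[-n, 0]` gives
record minima `T n → -∞` with `φ (T n) → 0`. A subsequence of the translates `φ (· + T n)` converges
to a solution vanishing at `0`, hence identically by (P). Divide by `φ (T n)`: since the arguments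
of `g` tend to zero, Fatou turns the equation into `ν * y ≤ y`, where `ν` is the convolution measure
of the linearization, `y 0 = 1`, and `y ≥ 1` on `[0, ∞)` because the minima are records
(`exists_char_nonneg`).

The core is `MonoSuper.exists_lintegral_expWeight_le_one`: such a `y` forces `∫ e^{-zs} dν ≤ 1`,
that is `χ(z) ≥ 0`, for some `z ≥ 0`. Replacing `y` by its infimum to the right makes it monotone.
The exponent `z` is then the abscissa of convergence of the Laplace transform of this monotone
function, unless `ν` lives on `(0, ∞)`, where any large `z` works.

As `χ(0) < 0`, the intermediate value theorem gives a positive zero of `χ`. Reflection `s ↦ -s`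
treats `+∞`. A pulse would give `χ ≥ 0` on both sides of `0`, which concavity of `χ` forbids. -/

noncomputable section

namespace ConvEq

/-! ### Monotone supersolutions of `u = ν * u` and Laplace transforms. -/

/-- The exponential weight `e^{-zh}` as an extended nonnegative number. -/
def expWeight (z h : ℝ) : ENNReal := ENNReal.ofReal (Real.exp (-(h * z)))

theorem measurable_expWeight (z : ℝ) : Measurable (expWeight z) := by
  unfold expWeight; fun_prop

theorem expWeight_add_right (z h k : ℝ) :
    expWeight z (h + k) = expWeight z h * expWeight z k := by
  rw [expWeight, expWeight, expWeight, ← ENNReal.ofReal_mul (Real.exp_nonneg _), ← Real.exp_add]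
  congr 2; ring

theorem expWeight_anti {z w h : ℝ} (hh : 0 ≤ h) (hzw : z ≤ w) : expWeight w h ≤ expWeight z h := by
  apply ENNReal.ofReal_le_ofReal
  apply Real.exp_le_exp.2
  nlinarith

theorem expWeight_zero (h : ℝ) : expWeight 0 h = 1 := by simp [expWeight]

/-- `u` is a nondecreasing supersolution of the linear equation `u = ν * u`, normalized by
`0 < u 0 < ∞`. -/
structure MonoSuper (ν : Measure ℝ) (u : ℝ → ENNReal) : Prop where
  mono : Monotone u
  le : ∀ t, ∫⁻ s, u (t - s) ∂ν ≤ u t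
  ne_zero : u 0 ≠ 0
  ne_top : u 0 ≠ ⊤

namespace MonoSuper

variable {ν : Measure ℝ} {u : ℝ → ENNReal}

theorem measurable (hu : MonoSuper ν u) : Measurable u := hu.mono.measurable

/-- Mass of `ν` on the negative half-line samples `u` to the right of `t`: some `(-∞, -a]` has mass
`c > 0`, and there `u (t - s) ≥ u (t + a)`. Hence `u` grows at most exponentially. -/
theorem exists_shift [IsFiniteMeasure ν] (hu : MonoSuper ν u) (hν : ν (Iio 0) ≠ 0) :
    ∃ a : ℝ, 0 < a ∧ ∃ c : ENNReal, c ≠ 0 ∧ c ≠ ⊤ ∧ ∀ t, c * u (t + a) ≤ u t := by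
  have hU : Iio (0 : ℝ) = ⋃ n : ℕ, Iic (-(1 / ((n : ℝ) + 1))) := by
    ext x
    simp only [mem_Iio, mem_iUnion, mem_Iic]
    constructor
    · intro hx
      obtain ⟨n, hn⟩ := exists_nat_one_div_lt (show 0 < -x by linarith)
      exact ⟨n, by linarith⟩
    · rintro ⟨n, hn⟩
      have : 0 < 1 / ((n : ℝ) + 1) := by positivity
      linarith
  have : ∃ n : ℕ, ν (Iic (-(1 / ((n : ℝ) + 1)))) ≠ 0 := by
    by_contra! h
    exact hν (by rw [hU]; exact measure_iUnion_null h)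
  obtain ⟨n, hn⟩ := this
  refine ⟨1 / ((n : ℝ) + 1), by positivity, _, hn, measure_ne_top _ _, fun t => ?_⟩
  calc ν (Iic (-(1 / ((n : ℝ) + 1)))) * u (t + 1 / ((n : ℝ) + 1))
      = ∫⁻ s in Iic (-(1 / ((n : ℝ) + 1))), u (t + 1 / ((n : ℝ) + 1)) ∂ν := by
        rw [setLIntegral_const, mul_comm]
    _ ≤ ∫⁻ s in Iic (-(1 / ((n : ℝ) + 1))), u (t - s) ∂ν := by
        refine setLIntegral_mono' measurableSet_Iic fun s hs => hu.mono ?_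
        simp only [mem_Iic] at hs
        linarith
    _ ≤ ∫⁻ s, u (t - s) ∂ν := setLIntegral_le_lintegral _ _
    _ ≤ u t := hu.le t

theorem ne_top_of_shift (hu : MonoSuper ν u) {a : ℝ} (ha : 0 < a) {c : ENNReal} (hc : c ≠ 0)
    (h : ∀ t, c * u (t + a) ≤ u t) (t : ℝ) : u t ≠ ⊤ := by
  have key : ∀ k : ℕ, u (k * a) ≠ ⊤ := by
    intro k
    induction k with
    | zero => simpa using hu.ne_top
    | succ k ih =>
      intro htop
      have := h (k * a)
      rw [show (k : ℝ) * a + a = ((k + 1 : ℕ) : ℝ) * a by push_cast; ring, htop,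
        ENNReal.mul_top hc] at this
      exact ih (top_le_iff.1 this)
  obtain ⟨k, hk⟩ := exists_nat_ge (t / a)
  exact ne_top_of_le_ne_top (key k) (hu.mono ((div_le_iff₀ ha).1 hk))

/-- The weighted integral of `u` over `(a, b]`. -/
def wInt (u : ℝ → ENNReal) (z a b : ℝ) : ENNReal := ∫⁻ h in Ioc a b, expWeight z h * u h

theorem measurable_weight (hu : MonoSuper ν u) (z : ℝ) :
    Measurable fun h => expWeight z h * u h := (measurable_expWeight z).mul hu.measurable

theorem wInt_ne_top (hu : MonoSuper ν u) (hfin : ∀ t, u t ≠ ⊤) {z : ℝ} (hz : 0 ≤ z) (b : ℝ) :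
    wInt u z 0 b ≠ ⊤ := by
  refine ne_top_of_le_ne_top (b := ∫⁻ _ in Ioc 0 b, u b) ?_ ?_
  · rw [setLIntegral_const]
    exact ENNReal.mul_ne_top (hfin b) (by simp)
  · refine setLIntegral_mono' measurableSet_Ioc fun h hh => ?_
    calc expWeight z h * u h ≤ 1 * u b := by
          gcongr
          · rw [← expWeight_zero h]
            exact expWeight_anti hh.1.le hz
          · exact hu.mono hh.2
      _ = u b := one_mul _

theorem wInt_add {z a b c : ℝ} (hab : a ≤ b) (hbc : b ≤ c) :
    wInt u z a b + wInt u z b c = wInt u z a c := by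
  rw [wInt, wInt, wInt, ← Ioc_union_Ioc_eq_Ioc hab hbc,
    lintegral_union measurableSet_Ioc (Ioc_disjoint_Ioc_of_le le_rfl)]

theorem wInt_mono {z a b c : ℝ} (hbc : b ≤ c) : wInt u z a b ≤ wInt u z a c :=
  lintegral_mono_set (Ioc_subset_Ioc_right hbc)

theorem wInt_shift (hu : MonoSuper ν u) (z a b s : ℝ) :
    ∫⁻ h in Ioc a b, expWeight z h * u (h - s) = expWeight z s * wInt u z (a - s) (b - s) := by
  have hm := hu.measurable_weight z
  rw [wInt, ← lintegral_const_mul _ hm, ← lintegral_indicator measurableSet_Ioc,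
    ← lintegral_indicator measurableSet_Ioc,
    ← lintegral_sub_right_eq_self ((Ioc (a - s) (b - s)).indicator _) s]
  congr 1
  ext h
  by_cases hh : h ∈ Ioc a b
  · rw [indicator_of_mem hh, indicator_of_mem (by simpa using hh), ← mul_assoc,
      ← expWeight_add_right]
    congr 2; ring
  · rw [indicator_of_notMem hh, indicator_of_notMem (by simpa using hh)]

theorem iSup_wInt (z a : ℝ) :
    ⨆ n : ℕ, wInt u z a n = ∫⁻ h in Ioi a, expWeight z h * u h := by
  have : Ioi a = ⋃ n : ℕ, Ioc a (n : ℝ) := by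
    ext x
    simp only [mem_Ioi, mem_iUnion, mem_Ioc]
    exact ⟨fun hx => (exists_nat_ge x).imp fun n hn => ⟨hx, hn⟩, fun ⟨n, hn⟩ => hn.1⟩
  rw [this, setLIntegral_iUnion_of_directed]
  · rfl
  · exact directed_of_isDirected_le fun m n hmn => Ioc_subset_Ioc_right (by exact_mod_cast hmn)

/-- Once `e^{-az} ≤ c / 2`, the shift inequality bounds the integral over `(a, n]` by half of that
over `(0, n]`. Absorbing this half leaves a bound independent of `n`. -/
theorem exists_lintegral_ne_top (hu : MonoSuper ν u) {a : ℝ} (ha : 0 < a) {c : ENNReal}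
    (hc : c ≠ 0) (hct : c ≠ ⊤) (h : ∀ t, c * u (t + a) ≤ u t) :
    ∃ z : ℝ, 0 ≤ z ∧ ∫⁻ h in Ioi 0, expWeight z h * u h ≠ ⊤ := by
  have hfin := hu.ne_top_of_shift ha hc h
  have hc' : 0 < c.toReal := ENNReal.toReal_pos hc hct
  obtain ⟨z, hz0, hz⟩ : ∃ z : ℝ, 0 ≤ z ∧ Real.exp (-(a * z)) ≤ c.toReal / 2 := by
    have : Tendsto (fun z : ℝ => Real.exp (-(a * z))) atTop (𝓝 0) :=
      Real.tendsto_exp_neg_atTop_nhds_zero.comp (tendsto_id.const_mul_atTop ha)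
    exact ((eventually_ge_atTop 0).and
      (this.eventually_le_const (show (0 : ℝ) < c.toReal / 2 by positivity))).exists
  refine ⟨z, hz0, ?_⟩
  rw [← iSup_wInt]
  have hw : expWeight z a ≤ c / 2 := by
    rw [← ENNReal.ofReal_toReal hct, show (2 : ENNReal) = ENNReal.ofReal 2 by simp,
      ← ENNReal.ofReal_div_of_pos (by norm_num)]
    exact ENNReal.ofReal_le_ofReal hz
  have key : ∀ n : ℕ, wInt u z 0 n ≤ 2 * wInt u z 0 a := by
    intro n
    have hI := hu.wInt_ne_top hfin hz0 n
    have h1 : c * wInt u z a n ≤ c / 2 * wInt u z 0 n := by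
      calc c * wInt u z a n = ∫⁻ h in Ioc a n, c * (expWeight z h * u h) := by
            rw [wInt, lintegral_const_mul _ (hu.measurable_weight z)]
        _ ≤ ∫⁻ h in Ioc a n, expWeight z h * u (h - a) := by
            refine lintegral_mono fun x => ?_
            have := h (x - a)
            rw [sub_add_cancel] at this
            calc c * (expWeight z x * u x) = expWeight z x * (c * u x) := by ring
              _ ≤ _ := by gcongr
        _ = expWeight z a * wInt u z 0 (n - a) := by rw [hu.wInt_shift, sub_self]
        _ ≤ c / 2 * wInt u z 0 n := by
            gcongr
            exact wInt_mono (by linarith)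
    have h2 : wInt u z a n ≤ wInt u z 0 n / 2 := by
      rw [← ENNReal.mul_le_mul_iff_right hc hct]
      calc _ ≤ _ := h1
        _ = _ := by simp only [div_eq_mul_inv]; ring
    have h3 : wInt u z 0 n ≤ wInt u z 0 a + wInt u z 0 n / 2 := by
      rcases le_total a n with han | han
      · rw [← wInt_add ha.le han]
        gcongr
        rwa [wInt_add ha.le han]
      · exact (wInt_mono han).trans le_self_add
    have h4 : wInt u z 0 n / 2 ≤ wInt u z 0 a := by
      have : wInt u z 0 n / 2 + wInt u z 0 n / 2 ≤ wInt u z 0 a + wInt u z 0 n / 2 := by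
        rwa [ENNReal.add_halves]
      exact (ENNReal.add_le_add_iff_right (ENNReal.div_ne_top hI (by norm_num))).1 this
    calc wInt u z 0 n = 2 * (wInt u z 0 n / 2) := by
          rw [ENNReal.mul_div_cancel (by norm_num) (by norm_num)]
      _ ≤ _ := by gcongr
  exact ne_top_of_le_ne_top (ENNReal.mul_ne_top (by norm_num) (hu.wInt_ne_top hfin hz0 a))
    (iSup_le key)

/-- Integrate `ν * u ≤ u` against `e^{-zh}` over `(0, T + R]` and use Tonelli. For `|s| ≤ R` the
shifted window `(-s, T + R - s]` still contains `(R, T]`. -/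
theorem mul_wInt_le [SFinite ν] (hu : MonoSuper ν u) (z R T : ℝ) :
    (∫⁻ s in Icc (-R) R, expWeight z s ∂ν) * wInt u z R T ≤ wInt u z 0 (T + R) := by
  calc (∫⁻ s in Icc (-R) R, expWeight z s ∂ν) * wInt u z R T
      = ∫⁻ s in Icc (-R) R, expWeight z s * wInt u z R T ∂ν := by
        rw [lintegral_mul_const _ (measurable_expWeight z)]
    _ ≤ ∫⁻ s in Icc (-R) R, expWeight z s * wInt u z (0 - s) (T + R - s) ∂ν := by
        refine setLIntegral_mono' measurableSet_Icc fun s hs => ?_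
        gcongr
        exact lintegral_mono_set (Ioc_subset_Ioc (by linarith [hs.1]) (by linarith [hs.2]))
    _ ≤ ∫⁻ s, expWeight z s * wInt u z (0 - s) (T + R - s) ∂ν := setLIntegral_le_lintegral _ _
    _ = ∫⁻ s, (∫⁻ h in Ioc 0 (T + R), expWeight z h * u (h - s)) ∂ν := by
        simp_rw [hu.wInt_shift]
    _ = ∫⁻ h in Ioc 0 (T + R), (∫⁻ s, expWeight z h * u (h - s) ∂ν) := by
        refine lintegral_lintegral_swap (Measurable.aemeasurable ?_)
        exact ((measurable_expWeight z).comp measurable_snd).mul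
          (hu.measurable.comp (measurable_snd.sub measurable_fst))
    _ = ∫⁻ h in Ioc 0 (T + R), (expWeight z h * ∫⁻ s, u (h - s) ∂ν) := by
        congr 1; ext h
        exact lintegral_const_mul _ (hu.measurable.comp (measurable_const.sub measurable_id))
    _ ≤ wInt u z 0 (T + R) := lintegral_mono fun h => by gcongr; exact hu.le h

/-- `mul_wInt_le` would give growth by the full factor `m` but for the boundary term `A` over `(0,
R]`. Since the weighted integral diverges, the gap `m - q` eventually pays for `A`. -/
theorem eventually_growth [IsFiniteMeasure ν] (hu : MonoSuper ν u) (hfin : ∀ t, u t ≠ ⊤)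
    {z R : ℝ} (hz : 0 ≤ z) (hR : 0 < R) (hdiv : ∫⁻ h in Ioi 0, expWeight z h * u h = ⊤)
    {q : ENNReal} (hq : q < ∫⁻ s in Icc (-R) R, expWeight z s ∂ν) :
    ∃ T₀ : ℝ, 0 ≤ T₀ ∧ wInt u z R T₀ ≠ 0 ∧
      ∀ T, T₀ ≤ T → q * wInt u z R T ≤ wInt u z R (T + R) := by
  set m := ∫⁻ s in Icc (-R) R, expWeight z s ∂ν with hm
  set A := wInt u z 0 R with hA
  have hAfin : A ≠ ⊤ := hu.wInt_ne_top hfin hz R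
  have hJtop : ⨆ n : ℕ, wInt u z R n = ⊤ := by
    rw [iSup_wInt]
    have h1 : (∫⁻ h in Ioc 0 R, expWeight z h * u h) + ∫⁻ h in Ioi R, expWeight z h * u h = ⊤ := by
      rw [← hdiv, ← Ioc_union_Ioi_eq_Ioi hR.le, lintegral_union measurableSet_Ioi]
      exact Set.disjoint_left.2 fun x hx hx' => not_lt.2 hx.2 hx'
    rcases ENNReal.add_eq_top.1 h1 with h | h
    · exact absurd h hAfin
    · exact h
  have hmq : m - q ≠ 0 := (tsub_pos_of_lt hq).ne'
  have hlt : A / (m - q) < ⊤ := ENNReal.div_lt_top hAfin hmq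
  rw [← hJtop] at hlt
  obtain ⟨n, hn⟩ := lt_iSup_iff.1 hlt
  have hR' : R < n := by
    by_contra! h
    simp [wInt, Ioc_eq_empty_of_le h] at hn
  refine ⟨n, Nat.cast_nonneg n, (bot_le.trans_lt hn).ne', fun T hT => ?_⟩
  have h1 : A ≤ (m - q) * wInt u z R T := by
    calc A ≤ wInt u z R n * (m - q) := ENNReal.div_le_iff_le_mul (Or.inl hmq)
            (Or.inr (bot_le.trans_lt hn).ne') |>.1 hn.le
      _ ≤ wInt u z R T * (m - q) := by gcongr; exact wInt_mono hT
      _ = _ := mul_comm _ _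
  have h2 : m * wInt u z R T ≤ A + wInt u z R (T + R) := by
    rw [hA, wInt_add hR.le (by linarith)]
    exact hu.mul_wInt_le z R T
  have h3 : q * wInt u z R T + A ≤ wInt u z R (T + R) + A := by
    calc q * wInt u z R T + A ≤ q * wInt u z R T + (m - q) * wInt u z R T := by gcongr
      _ = m * wInt u z R T := by rw [← add_mul, add_tsub_cancel_of_le hq.le]
      _ ≤ _ := by rw [add_comm _ A]; exact h2
  exact (ENNReal.add_le_add_iff_right hAfin).1 h3

theorem wInt_le_of_lintegral {z δ : ℝ} (hδ : 0 ≤ δ) {T R : ℝ} (hR : 0 < R) :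
    wInt u z R T ≤ ENNReal.ofReal (Real.exp (δ * T)) *
      ∫⁻ h in Ioi 0, expWeight (z + δ) h * u h := by
  rw [← lintegral_const_mul' _ _ ENNReal.ofReal_ne_top]
  calc wInt u z R T ≤ ∫⁻ h in Ioc R T, ENNReal.ofReal (Real.exp (δ * T)) *
        (expWeight (z + δ) h * u h) := by
        refine setLIntegral_mono' measurableSet_Ioc fun h hh => ?_
        rw [← mul_assoc]
        gcongr
        rw [expWeight, expWeight, ← ENNReal.ofReal_mul (Real.exp_nonneg _), ← Real.exp_add]
        apply ENNReal.ofReal_le_ofReal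
        apply Real.exp_le_exp.2
        nlinarith [hh.2]
    _ ≤ _ := lintegral_mono_set fun x hx => hR.trans hx.1

/-- If the truncated mass exceeded `e^{2εR}`, the weighted integral would gain that factor at each
step of length `R`, whereas convergence at `z + ε` allows only `e^{εR}` per step. -/
theorem truncated_le [IsFiniteMeasure ν] (hu : MonoSuper ν u) (hfin : ∀ t, u t ≠ ⊤)
    {z R ε : ℝ} (hz : 0 ≤ z) (hR : 0 < R) (hε : 0 < ε)
    (hdiv : ∫⁻ h in Ioi 0, expWeight z h * u h = ⊤)
    (hconv : ∫⁻ h in Ioi 0, expWeight (z + ε) h * u h ≠ ⊤) :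
    ∫⁻ s in Icc (-R) R, expWeight z s ∂ν ≤ ENNReal.ofReal (Real.exp (2 * ε * R)) := by
  by_contra! hq
  obtain ⟨T₀, hT₀, hne, hgrow⟩ := hu.eventually_growth hfin hz hR hdiv hq
  set C := ∫⁻ h in Ioi 0, expWeight (z + ε) h * u h with hC
  have hpow : ∀ k : ℕ, ENNReal.ofReal (Real.exp (2 * ε * R)) ^ k * wInt u z R T₀ ≤
      wInt u z R (T₀ + k * R) := by
    intro k
    induction k with
    | zero => simp
    | succ k ih =>
      calc _ = ENNReal.ofReal (Real.exp (2 * ε * R)) *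
            (ENNReal.ofReal (Real.exp (2 * ε * R)) ^ k * wInt u z R T₀) := by ring
        _ ≤ ENNReal.ofReal (Real.exp (2 * ε * R)) * wInt u z R (T₀ + k * R) := by gcongr
        _ ≤ wInt u z R (T₀ + k * R + R) := hgrow _ (by nlinarith [Nat.cast_nonneg (α := ℝ) k])
        _ = _ := by congr 1; push_cast; ring
  have hJfin : wInt u z R T₀ ≠ ⊤ :=
    ne_top_of_le_ne_top (ENNReal.mul_ne_top ENNReal.ofReal_ne_top hconv)
      (wInt_le_of_lintegral hε.le hR)
  have hreal : ∀ k : ℕ, Real.exp (ε * R * k) * (wInt u z R T₀).toReal ≤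
      Real.exp (ε * T₀) * C.toReal := by
    intro k
    have h1 := (hpow k).trans (wInt_le_of_lintegral (u := u) (z := z) hε.le hR)
    have h2 := ENNReal.toReal_mono (ENNReal.mul_ne_top ENNReal.ofReal_ne_top hconv) h1
    rw [ENNReal.toReal_mul, ENNReal.toReal_mul, ENNReal.toReal_pow,
      ENNReal.toReal_ofReal (Real.exp_nonneg _), ENNReal.toReal_ofReal (Real.exp_nonneg _),
      ← Real.exp_nat_mul] at h2
    have h3 : Real.exp (k * (2 * ε * R)) = Real.exp (ε * R * k) * Real.exp (ε * R * k) := by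
      rw [← Real.exp_add]; congr 1; ring
    have h4 : Real.exp (ε * (T₀ + k * R)) = Real.exp (ε * R * k) * Real.exp (ε * T₀) := by
      rw [← Real.exp_add]; congr 1; ring
    rw [h3, h4, mul_assoc (Real.exp (ε * R * k)), mul_assoc (Real.exp (ε * R * k))] at h2
    exact le_of_mul_le_mul_left h2 (Real.exp_pos _)
  have hJ : 0 < (wInt u z R T₀).toReal := ENNReal.toReal_pos hne hJfin
  have htend : Tendsto (fun k : ℕ => Real.exp (ε * R * k) * (wInt u z R T₀).toReal) atTop atTop :=
    (Real.tendsto_exp_atTop.comp (tendsto_natCast_atTop_atTop.const_mul_atTop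
      (mul_pos hε hR))).atTop_mul_const hJ
  obtain ⟨k, hk⟩ := (htend.eventually_gt_atTop (Real.exp (ε * T₀) * C.toReal)).exists
  exact absurd (hreal k) (not_le.2 hk)

theorem lintegral_zero_eq_top (hu : MonoSuper ν u) :
    ∫⁻ h in Ioi 0, expWeight 0 h * u h = ⊤ := by
  simp_rw [expWeight_zero, one_mul]
  refine top_le_iff.1 ?_
  calc (⊤ : ENNReal) = ∫⁻ _ in Ioi (0 : ℝ), u 0 := by
        rw [setLIntegral_const, Real.volume_Ioi, ENNReal.mul_top hu.ne_zero]
    _ ≤ _ := setLIntegral_mono' measurableSet_Ioi fun h hh => hu.mono (le_of_lt hh)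

/-- `σ` is the abscissa of convergence. The integral may converge or diverge at `σ` itself, so `σ`
is only bracketed by a point `z` of divergence and a point `z + ε` of convergence. -/
theorem exists_critical_exponent (hu : MonoSuper ν u)
    (hex : ∃ z : ℝ, 0 ≤ z ∧ ∫⁻ h in Ioi 0, expWeight z h * u h ≠ ⊤) :
    ∃ σ : ℝ, 0 ≤ σ ∧ ∀ ε > 0, ∃ z, 0 ≤ z ∧ z ≤ σ ∧ σ < z + ε ∧
      ∫⁻ h in Ioi 0, expWeight z h * u h = ⊤ ∧
      ∫⁻ h in Ioi 0, expWeight (z + ε) h * u h ≠ ⊤ := by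
  obtain ⟨w, hw0, hw⟩ := hex
  set S := {z : ℝ | 0 ≤ z ∧ ∫⁻ h in Ioi 0, expWeight z h * u h = ⊤} with hS
  have h0 : (0 : ℝ) ∈ S := ⟨le_rfl, hu.lintegral_zero_eq_top⟩
  have hbdd : BddAbove S := by
    refine ⟨w, fun z hz => ?_⟩
    by_contra! hlt
    refine hw (top_le_iff.1 ?_)
    rw [← hz.2]
    exact setLIntegral_mono' measurableSet_Ioi fun h hh => by
      gcongr; exact expWeight_anti (le_of_lt hh) hlt.le
  refine ⟨sSup S, le_csSup hbdd h0, fun ε hε => ?_⟩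
  obtain ⟨z, hz, hlt⟩ := exists_lt_of_lt_csSup ⟨0, h0⟩ (sub_lt_self (sSup S) hε)
  refine ⟨z, hz.1, le_csSup hbdd hz, by linarith, hz.2, fun htop => ?_⟩
  have : z + ε ≤ sSup S := le_csSup hbdd ⟨by linarith [hz.1], htop⟩
  linarith

theorem exists_lintegral_expWeight_le_one [IsFiniteMeasure ν] (hu : MonoSuper ν u)
    (hν : ν {0} = 0) : ∃ z : ℝ, 0 ≤ z ∧ ∫⁻ s, expWeight z s ∂ν ≤ 1 := by
  -- Without mass on `(-∞, 0]` the transform tends to `0` as `z → ∞`; an atom at `0` would not be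
  -- damped, whence `hν`.
  by_cases hneg : ν (Iio 0) = 0
  · have hpos : ∀ᵐ s ∂ν, 0 < s := by
      rw [ae_iff]
      refine measure_mono_null (t := Iio 0 ∪ {0}) (fun s hs => ?_)
        (measure_union_null hneg hν)
      simpa using not_lt.1 hs
    have hlim : Tendsto (fun n : ℕ => ∫⁻ s, expWeight n s ∂ν) atTop (𝓝 (∫⁻ _, 0 ∂ν)) := by
      refine tendsto_lintegral_of_dominated_convergence (fun _ => 1)
        (fun n => measurable_expWeight n) (fun n => ?_) ?_ ?_
      · filter_upwards [hpos] with s hs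
        rw [← expWeight_zero s]
        exact expWeight_anti hs.le (Nat.cast_nonneg n)
      · simp
      · filter_upwards [hpos] with s hs
        rw [← ENNReal.ofReal_zero]
        refine ENNReal.tendsto_ofReal ?_
        exact Real.tendsto_exp_neg_atTop_nhds_zero.comp
          (tendsto_natCast_atTop_atTop.const_mul_atTop hs)
    rw [lintegral_zero] at hlim
    obtain ⟨n, hn⟩ := (hlim.eventually_le_const (show (0 : ENNReal) < 1 by simp)).exists
    exact ⟨n, Nat.cast_nonneg n, hn⟩
  · obtain ⟨a, ha, c, hc, hct, h⟩ := hu.exists_shift hneg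
    have hfin := hu.ne_top_of_shift ha hc h
    obtain ⟨σ, hσ, hcrit⟩ :=
      hu.exists_critical_exponent (hu.exists_lintegral_ne_top ha hc hct h)
    refine ⟨σ, hσ, ?_⟩
    have hR : ∀ R : ℝ, 0 < R → ∫⁻ s in Icc (-R) R, expWeight σ s ∂ν ≤ 1 := by
      intro R hR
      -- The exponent `3Rε` is `2εR` from `truncated_le` plus `εR` for replacing `σ` by `z` on `|s|
      -- ≤ R`. Then `ε → 0`, and afterwards `R → ∞`.
      have hε : ∀ ε : ℝ, 0 < ε → ∫⁻ s in Icc (-R) R, expWeight σ s ∂ν ≤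
          ENNReal.ofReal (Real.exp (3 * R * ε)) := by
        intro ε hε
        obtain ⟨z, hz, hzσ, hσz, hdiv, hconv⟩ := hcrit ε hε
        calc ∫⁻ s in Icc (-R) R, expWeight σ s ∂ν
            ≤ ∫⁻ s in Icc (-R) R, ENNReal.ofReal (Real.exp (ε * R)) * expWeight z s ∂ν := by
              refine setLIntegral_mono' measurableSet_Icc fun s hs => ?_
              rw [expWeight, expWeight, ← ENNReal.ofReal_mul (Real.exp_nonneg _), ← Real.exp_add]
              apply ENNReal.ofReal_le_ofReal
              apply Real.exp_le_exp.2
              nlinarith [hs.1, hs.2, mul_nonneg (sub_nonneg.2 hzσ) (neg_le_iff_add_nonneg.1 hs.1),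
                mul_nonneg (sub_nonneg.2 hσz.le) hR.le]
          _ = ENNReal.ofReal (Real.exp (ε * R)) * ∫⁻ s in Icc (-R) R, expWeight z s ∂ν :=
              lintegral_const_mul _ (measurable_expWeight z)
          _ ≤ ENNReal.ofReal (Real.exp (ε * R)) * ENNReal.ofReal (Real.exp (2 * ε * R)) := by
              gcongr
              exact hu.truncated_le hfin hz hR hε hdiv hconv
          _ = _ := by
              rw [← ENNReal.ofReal_mul (Real.exp_nonneg _), ← Real.exp_add]
              congr 2; ring
      have hlim : Tendsto (fun ε : ℝ => ENNReal.ofReal (Real.exp (3 * R * ε))) (𝓝[>] 0) (𝓝 1) := by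
        have : Continuous fun ε : ℝ => ENNReal.ofReal (Real.exp (3 * R * ε)) :=
          ENNReal.continuous_ofReal.comp (by fun_prop)
        simpa using (this.tendsto 0).mono_left nhdsWithin_le_nhds
      exact ge_of_tendsto hlim (by filter_upwards [self_mem_nhdsWithin] with ε hε' using hε ε hε')
    have hU : (univ : Set ℝ) = ⋃ n : ℕ, Icc (-((n : ℝ) + 1)) ((n : ℝ) + 1) := by
      refine (eq_univ_of_forall fun x => ?_).symm
      obtain ⟨n, hn⟩ := exists_nat_ge |x|
      exact mem_iUnion.2 ⟨n, by linarith [neg_abs_le x], by linarith [le_abs_self x]⟩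
    rw [← setLIntegral_univ, hU, setLIntegral_iUnion_of_directed]
    · exact iSup_le fun n => hR _ (by positivity)
    · refine directed_of_isDirected_le fun m n hmn => ?_
      have : (m : ℝ) ≤ n := by exact_mod_cast hmn
      exact Icc_subset_Icc (by linarith) (by linarith)

end MonoSuper

/-- A positive lower bound on `[0, ∞)` for a supersolution of `y = ν * y` forces the Laplace
transform of `ν` to drop to `1` or below somewhere on `[0, ∞)`. -/
theorem exists_lintegral_expWeight_le_one {ν : Measure ℝ} [IsFiniteMeasure ν] (hν : ν {0} = 0)
    {y : ℝ → ENNReal} (hy : ∀ t, ∫⁻ s, y (t - s) ∂ν ≤ y t) (hy0 : y 0 ≠ ⊤)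
    {c : ENNReal} (hc : c ≠ 0) (hyc : ∀ t, 0 ≤ t → c ≤ y t) :
    ∃ z : ℝ, 0 ≤ z ∧ ∫⁻ s, expWeight z s ∂ν ≤ 1 := by
  -- The infimum over `[t, ∞)` is monotone in `t` and remains a supersolution, since the inequality
  -- for `y` holds at each `t + h`.
  have hsuper : MonoSuper ν fun t => ⨅ h : Ici (0 : ℝ), y (t + h) := by
    refine ⟨fun t t' htt' => ?_, fun t => ?_, ?_, ?_⟩
    · refine le_iInf fun h => ?_
      refine (iInf_le _ ⟨t' - t + h, add_nonneg (sub_nonneg.2 htt') h.2⟩).trans (le_of_eq ?_)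
      congr 1; ring
    · refine le_iInf fun h => (lintegral_mono fun s => ?_).trans (hy _)
      refine (iInf_le _ h).trans (le_of_eq ?_)
      congr 1; ring
    · refine (lt_of_lt_of_le (pos_iff_ne_zero.2 hc) (le_iInf fun h => ?_)).ne'
      exact hyc _ (add_nonneg le_rfl h.2)
    · refine ne_top_of_le_ne_top hy0 ((iInf_le _ ⟨0, self_mem_Ici⟩).trans (le_of_eq ?_))
      simp
  exact hsuper.exists_lintegral_expWeight_le_one hν

/-! ### Linearization at zero and the characteristic function. -/

section Linearization

variable {X : Type*} [MeasurableSpace X] {μ : Measure X} {K : ℝ → X → ℝ} {g : ℝ → X → ℝ}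

theorem Data.charIntegrand_nonneg (hd : Data μ K g) (z : ℝ) (p : ℝ × X) :
    0 ≤ charIntegrand K g z p :=
  mul_nonneg (mul_nonneg (hd.K_nonneg _ _) (hd.g_slope_pos _).le) (Real.exp_nonneg _)

theorem charIntegrand_eq {Y : Type*} (K g : ℝ → Y → ℝ) (z : ℝ) (p : ℝ × Y) :
    charIntegrand K g z p = charIntegrand K g 0 p * Real.exp (-(p.1 * z)) := by
  simp [charIntegrand]

theorem ofReal_charIntegrand (hd : Data μ K g) (z : ℝ) (p : ℝ × X) :
    ENNReal.ofReal (charIntegrand K g z p) =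
      ENNReal.ofReal (charIntegrand K g 0 p) * expWeight z p.1 := by
  rw [charIntegrand_eq, ENNReal.ofReal_mul (hd.charIntegrand_nonneg 0 p)]
  rfl

theorem CharDefined.aestronglyMeasurable (h : CharDefined μ K g 0) (z : ℝ) :
    AEStronglyMeasurable (charIntegrand K g z) (volume.prod μ) := by
  have : charIntegrand K g z = fun p => charIntegrand K g 0 p * Real.exp (-(p.1 * z)) :=
    funext fun p => charIntegrand_eq K g z p
  rw [this]
  exact h.1.mul (Measurable.aestronglyMeasurable (by fun_prop))

/-- The convolution measure on `ℝ` of the linearization at zero. -/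
def linMeasure (μ : Measure X) (K : ℝ → X → ℝ) (g : ℝ → X → ℝ) : Measure ℝ :=
  ((volume.prod μ).withDensity fun p => ENNReal.ofReal (charIntegrand K g 0 p)).map Prod.fst

theorem isFiniteMeasure_linMeasure (h : CharDefined μ K g 0) :
    IsFiniteMeasure (linMeasure μ K g) := by
  have := isFiniteMeasure_withDensity_ofReal h.2
  unfold linMeasure
  infer_instance

theorem lintegral_linMeasure (h : CharDefined μ K g 0) {F : ℝ → ENNReal} (hF : Measurable F) :
    ∫⁻ s, F s ∂(linMeasure μ K g) =
      ∫⁻ p, ENNReal.ofReal (charIntegrand K g 0 p) * F p.1 ∂(volume.prod μ) := by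
  rw [linMeasure, lintegral_map hF measurable_fst]
  exact lintegral_withDensity_eq_lintegral_mul₀ h.1.aemeasurable.ennreal_ofReal
    (hF.comp measurable_fst).aemeasurable

theorem linMeasure_singleton [SFinite μ] : linMeasure μ K g {0} = 0 := by
  rw [linMeasure, Measure.map_apply measurable_fst (measurableSet_singleton 0)]
  refine withDensity_absolutelyContinuous _ _ ?_
  rw [show (Prod.fst : ℝ × X → ℝ) ⁻¹' {0} = {0} ×ˢ univ by ext; simp, Measure.prod_prod]
  simp

theorem lintegral_expWeight_linMeasure (hd : Data μ K g) (h : CharDefined μ K g 0) (z : ℝ) :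
    ∫⁻ s, expWeight z s ∂(linMeasure μ K g) =
      ∫⁻ p, ENNReal.ofReal (charIntegrand K g z p) ∂(volume.prod μ) := by
  rw [lintegral_linMeasure h (measurable_expWeight z)]
  exact lintegral_congr fun p => (ofReal_charIntegrand hd z p).symm

theorem charDefined_of_lintegral_le_one (hd : Data μ K g) (h : CharDefined μ K g 0) {z : ℝ}
    (hz : ∫⁻ s, expWeight z s ∂(linMeasure μ K g) ≤ 1) :
    CharDefined μ K g z ∧ 0 ≤ char μ K g z := by
  rw [lintegral_expWeight_linMeasure hd h] at hz
  have hnn : 0 ≤ᵐ[volume.prod μ] charIntegrand K g z :=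
    Eventually.of_forall (hd.charIntegrand_nonneg z)
  refine ⟨⟨h.aestronglyMeasurable z, ?_⟩, ?_⟩
  · rw [hasFiniteIntegral_iff_ofReal hnn]
    exact hz.trans_lt ENNReal.one_lt_top
  · rw [char, integral_eq_lintegral_of_nonneg_ae hnn (h.aestronglyMeasurable z), sub_nonneg]
    exact ENNReal.toReal_mono ENNReal.one_ne_top hz

theorem exp_mul_le_one_add_exp {l : ℝ} (h0 : 0 ≤ l) (h1 : l ≤ 1) (x : ℝ) :
    Real.exp (l * x) ≤ 1 + Real.exp x := by
  rcases le_total x 0 with hx | hx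
  · have : Real.exp (l * x) ≤ 1 := Real.exp_le_one_iff.2 (mul_nonpos_of_nonneg_of_nonpos h0 hx)
    linarith [Real.exp_pos x]
  · have : Real.exp (l * x) ≤ Real.exp x := Real.exp_le_exp.2 (mul_le_of_le_one_left hx h1)
    linarith

/-- The integrands at `0` and `z` together dominate those in between, so `χ` is defined and
continuous on the segment and the intermediate value theorem applies. The sign of `z` is free, so
both half-lines are covered. -/
theorem exists_isCharZero_of_char_nonneg (hd : Data μ K g) (h : CharDefined μ K g 0)
    (hneg : char μ K g 0 < 0) {z : ℝ} (hz : CharDefined μ K g z) (hz0 : 0 ≤ char μ K g z) :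
    ∃ l : ℝ, 0 < l ∧ IsCharZero μ K g (l * z) := by
  have hbound : ∀ l ∈ Icc (0 : ℝ) 1, ∀ p,
      ‖charIntegrand K g (l * z) p‖ ≤ charIntegrand K g 0 p + charIntegrand K g z p := by
    intro l hl p
    rw [Real.norm_of_nonneg (hd.charIntegrand_nonneg _ p), charIntegrand_eq K g (l * z),
      charIntegrand_eq K g z]
    have := exp_mul_le_one_add_exp hl.1 hl.2 (-(p.1 * z))
    rw [show -(p.1 * (l * z)) = l * -(p.1 * z) by ring]
    nlinarith [mul_le_mul_of_nonneg_left this (hd.charIntegrand_nonneg 0 p)]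
  have hcont : ContinuousOn (fun l : ℝ => char μ K g (l * z)) (Icc 0 1) := by
    refine continuousOn_const.sub (continuousOn_of_dominated
      (bound := fun p => charIntegrand K g 0 p + charIntegrand K g z p)
      (fun l _ => h.aestronglyMeasurable _)
      (fun l hl => Eventually.of_forall (hbound l hl)) (h.add hz)
      (Eventually.of_forall fun p => ?_))
    unfold charIntegrand
    fun_prop
  obtain ⟨l, hl, hzero⟩ := intermediate_value_Icc zero_le_one hcont
    (show (0 : ℝ) ∈ Icc _ _ by simpa using ⟨hneg.le, hz0⟩)
  simp only at hzero
  refine ⟨l, lt_of_le_of_ne hl.1 ?_, ?_, hzero⟩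
  · rintro rfl
    rw [zero_mul] at hzero
    linarith
  · exact (h.add hz).mono' (h.aestronglyMeasurable _) (Eventually.of_forall (hbound l hl))

theorem Data.tendsto_div (hd : Data μ K g) (τ : X) {x : ℕ → ℝ} (hx : ∀ n, 0 < x n)
    (hlim : Tendsto x atTop (𝓝 0)) :
    Tendsto (fun n => g (x n) τ / x n) atTop (𝓝 (slope0 g τ)) := by
  have h := hasDerivWithinAt_iff_tendsto_slope.1 (hd.g_differentiable τ).hasDerivWithinAt
  have hx' : Tendsto x atTop (𝓝[Ici 0 \ {0}] 0) :=
    tendsto_nhdsWithin_iff.2 ⟨hlim, Eventually.of_forall fun n => ⟨(hx n).le, (hx n).ne'⟩⟩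
  refine (h.comp hx').congr fun n => ?_
  simp only [Function.comp_apply, slope_def_field, hd.g_zero, sub_zero]

theorem IsSolution.ofReal_eq [SFinite μ] (hd : Data μ K g) {φ : ℝ → ℝ} (hφ : IsSolution μ K g φ)
    (t : ℝ) : ENNReal.ofReal (φ t) =
      ∫⁻ p, ENNReal.ofReal (K p.1 p.2 * g (φ (t - p.1)) p.2) ∂(volume.prod μ) := by
  rw [hφ.equation t, ← integral_prod_symm _ (hφ.integrable t),
    ofReal_integral_eq_lintegral_ofReal (hφ.integrable t)]
  exact Eventually.of_forall fun p =>
    mul_nonneg (hd.K_nonneg _ _) (hd.g_nonneg _ _ (hφ.nonneg _))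

/-- If a positive solution, translated by `T n`, tends to zero pointwise while `φ (T n)` is
eventually minimal among the values to its right, then `χ ≥ 0` somewhere on `(0, ∞)`. -/
theorem exists_char_nonneg [SFinite μ] (hd : Data μ K g) (h : CharDefined μ K g 0)
    (hneg : char μ K g 0 < 0) {φ : ℝ → ℝ} (hφ : IsSolution μ K g φ) (hpos : ∀ t, 0 < φ t)
    {T : ℕ → ℝ} (hT : ∀ t, Tendsto (fun n => φ (t + T n)) atTop (𝓝 0))
    (hmin : ∀ t, 0 ≤ t → ∀ᶠ n in atTop, φ (T n) ≤ φ (t + T n)) :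
    ∃ z : ℝ, 0 < z ∧ CharDefined μ K g z ∧ 0 ≤ char μ K g z := by
  have := isFiniteMeasure_linMeasure h
  set y : ℝ → ENNReal :=
    fun t => liminf (fun n => ENNReal.ofReal (φ (t + T n) / φ (T n))) atTop with hy
  have hym : Measurable y := Measurable.liminf fun n =>
    ((hφ.measurable.comp (measurable_id.add_const _)).div_const _).ennreal_ofReal
  have hsuper : ∀ t, ∫⁻ s, y (t - s) ∂(linMeasure μ K g) ≤ y t := by
    intro t
    rw [lintegral_linMeasure (F := fun s => y (t - s)) h (hym.comp (measurable_const.sub measurable_id))]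
    set f : ℕ → ℝ × X → ENNReal := fun n p =>
      ENNReal.ofReal (K p.1 p.2 * g (φ (t + T n - p.1)) p.2 / φ (T n)) with hf
    have hfm : ∀ n, AEMeasurable (f n) (volume.prod μ) := fun n =>
      ((hφ.integrable (t + T n)).1.aemeasurable.div_const _).ennreal_ofReal
    have hfi : ∀ n, ∫⁻ p, f n p ∂(volume.prod μ) = ENNReal.ofReal (φ (t + T n) / φ (T n)) := by
      intro n
      rw [ENNReal.ofReal_div_of_pos (hpos _), hφ.ofReal_eq hd, div_eq_mul_inv,
        ← lintegral_mul_const' _ _ (by simp [hpos])]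
      refine lintegral_congr fun p => ?_
      rw [hf]
      simp only
      rw [ENNReal.ofReal_div_of_pos (hpos _), div_eq_mul_inv]
    -- Fatou: the integrand is `K g(φ)/φ`, which tends to `K g'(0)`, times a quotient `φ (t - s + T
    -- n) / φ (T n)` whose liminf is `y (t - s)`.
    calc _ ≤ ∫⁻ p, liminf (fun n => f n p) atTop ∂(volume.prod μ) := by
          refine lintegral_mono fun p => ?_
          have hx : Tendsto (fun n => φ (t + T n - p.1)) atTop (𝓝 0) := by
            refine (hT (t - p.1)).congr fun n => ?_
            congr 1; ring
          have hlim : Tendsto (fun n => ENNReal.ofReal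
              (K p.1 p.2 * (g (φ (t + T n - p.1)) p.2 / φ (t + T n - p.1)))) atTop
              (𝓝 (ENNReal.ofReal (charIntegrand K g 0 p))) := by
            refine ENNReal.tendsto_ofReal ?_
            simp only [charIntegrand, mul_zero, neg_zero, Real.exp_zero, mul_one]
            exact (hd.tendsto_div p.2 (fun n => hpos _) hx).const_mul _
          calc _ = liminf (fun n => ENNReal.ofReal
                (K p.1 p.2 * (g (φ (t + T n - p.1)) p.2 / φ (t + T n - p.1)))) atTop *
                y (t - p.1) := by rw [hlim.liminf_eq]
            _ ≤ _ := ENNReal.le_liminf_mul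
            _ = _ := by
                refine liminf_congr (Eventually.of_forall fun n => ?_)
                simp only [Pi.mul_apply, hf]
                rw [← ENNReal.ofReal_mul (mul_nonneg (hd.K_nonneg _ _)
                  (div_nonneg (hd.g_nonneg _ _ (hpos _).le) (hpos _).le)),
                  show t - p.1 + T n = t + T n - p.1 by ring]
                congr 1
                have := (hpos (t + T n - p.1)).ne'
                field_simp
      _ ≤ liminf (fun n => ∫⁻ p, f n p ∂(volume.prod μ)) atTop := lintegral_liminf_le' hfm
      _ = y t := by simp_rw [hfi]; rfl
  have hy0 : y 0 = 1 := by
    simp only [hy, zero_add, div_self (hpos _).ne', ENNReal.ofReal_one, liminf_const]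
  obtain ⟨z, hz, hle⟩ := exists_lintegral_expWeight_le_one linMeasure_singleton hsuper
    (by simp [hy0]) one_ne_zero (fun t ht => by
      refine le_liminf_of_le (by isBoundedDefault) ?_
      filter_upwards [hmin t ht] with n hn
      rw [← ENNReal.ofReal_one]
      exact ENNReal.ofReal_le_ofReal ((one_le_div (hpos _)).2 hn))
  obtain ⟨hzd, hzc⟩ := charDefined_of_lintegral_le_one hd h hle
  refine ⟨z, lt_of_le_of_ne hz ?_, hzd, hzc⟩
  rintro rfl
  linarith

/-- The function `χ` is concave, so it cannot be nonnegative on both sides of a point where it is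
negative. -/
theorem not_char_nonneg_both (hd : Data μ K g) (h : CharDefined μ K g 0)
    (hneg : char μ K g 0 < 0) {z w : ℝ} (hz : 0 < z) (hw : w < 0)
    (hzd : CharDefined μ K g z) (hwd : CharDefined μ K g w)
    (hz0 : 0 ≤ char μ K g z) (hw0 : 0 ≤ char μ K g w) : False := by
  have hle : (∫ p, (z - w) * charIntegrand K g 0 p ∂(volume.prod μ)) ≤
      ∫ p, ((-w) * charIntegrand K g z p + z * charIntegrand K g w p) ∂(volume.prod μ) := by
    refine integral_mono (h.const_mul _) ((hzd.const_mul _).add (hwd.const_mul _)) fun p => ?_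
    simp only
    rw [charIntegrand_eq K g z, charIntegrand_eq K g w]
    have h0 := hd.charIntegrand_nonneg 0 p
    -- With weights `-w` and `z` the linear terms of the two tangent-line bounds cancel.
    have h1 := Real.add_one_le_exp (-(p.1 * z))
    have h2 := Real.add_one_le_exp (-(p.1 * w))
    have h3 : z - w ≤ (-w) * Real.exp (-(p.1 * z)) + z * Real.exp (-(p.1 * w)) := by
      nlinarith [mul_le_mul_of_nonneg_left h1 (neg_pos.2 hw).le,
        mul_le_mul_of_nonneg_left h2 hz.le]
    nlinarith [mul_le_mul_of_nonneg_left h3 h0]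
  rw [integral_const_mul, integral_add (hzd.const_mul _) (hwd.const_mul _), integral_const_mul,
    integral_const_mul] at hle
  unfold char at hneg hz0 hw0
  nlinarith

end Linearization

/-! ### Continuity of translations in `L¹` and of convolutions. -/

theorem tendsto_integral_norm_translate_sub {f : ℝ → ℝ} (hf : Integrable f) :
    Tendsto (fun d : ℝ => ∫ r, ‖f (d + r) - f r‖) (𝓝 0) (𝓝 0) := by
  have hL : MemLp f 1 volume := memLp_one_iff_integrable.2 hf
  have : Fact ((1 : ENNReal) ≠ ⊤) := ⟨ENNReal.one_ne_top⟩
  have hc : Continuous fun d : ℝ => ‖(DomAddAct.mk d +ᵥ hL.toLp f) - hL.toLp f‖ := by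
    have hmk : Continuous (DomAddAct.mk : ℝ → DomAddAct ℝ) := DomAddAct.continuous_mk
    fun_prop
  have h0 := hc.tendsto 0
  rw [show ‖(DomAddAct.mk (0 : ℝ) +ᵥ hL.toLp f) - hL.toLp f‖ = 0 by
    rw [DomAddAct.mk_zero, zero_vadd, sub_self, norm_zero]] at h0
  refine h0.congr fun d => ?_
  have hd : DomAddAct.mk d +ᵥ hL.toLp f =
      (memLp_one_iff_integrable.2 (hf.comp_add_left d)).toLp fun r => f (d + r) := rfl
  rw [hd, ← MemLp.toLp_sub, Lp.norm_toLp, eLpNorm_one_eq_lintegral_enorm,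
    integral_norm_eq_lintegral_enorm]
  · simp
  · exact (hf.comp_add_left d).1.sub hf.1

section Translation

variable {X : Type*} [MeasurableSpace X] {μ : Measure X}

/-- Translation of the first coordinate of `ℝ × X`. -/
def translateFst (X : Type*) [MeasurableSpace X] (d : ℝ) : ℝ × X ≃ᵐ ℝ × X :=
  (MeasurableEquiv.addLeft d).prodCongr (MeasurableEquiv.refl X)

theorem measurePreserving_translateFst [SFinite μ] (d : ℝ) :
    MeasurePreserving (translateFst X d) (volume.prod μ) (volume.prod μ) :=
  (measurePreserving_add_left volume d).prod (MeasurePreserving.id μ)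

theorem integrable_translateFst [SFinite μ] {G : ℝ × X → ℝ} (hG : Integrable G (volume.prod μ))
    (d : ℝ) : Integrable (fun p => G (d + p.1, p.2)) (volume.prod μ) :=
  ((measurePreserving_translateFst d).integrable_comp_emb
    (translateFst X d).measurableEmbedding).2 hG

theorem integral_translateFst [SFinite μ] (G : ℝ × X → ℝ) (d : ℝ) :
    ∫ p, G (d + p.1, p.2) ∂(volume.prod μ) = ∫ p, G p ∂(volume.prod μ) :=
  (measurePreserving_translateFst d).integral_comp' G

theorem tendsto_integral_norm_translateFst_sub [SFinite μ] {G : ℝ × X → ℝ}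
    (hG : Integrable G (volume.prod μ)) :
    Tendsto (fun d : ℝ => ∫ p, ‖G (d + p.1, p.2) - G p‖ ∂(volume.prod μ)) (𝓝 0) (𝓝 0) := by
  have hsub : ∀ d : ℝ, Integrable (fun p => ‖G (d + p.1, p.2) - G p‖) (volume.prod μ) :=
    fun d => ((integrable_translateFst hG d).sub hG).norm
  simp_rw [fun d : ℝ => integral_prod_symm _ (hsub d)]
  rw [show 𝓝 (0 : ℝ) = 𝓝 (∫ _ : X, (0 : ℝ) ∂μ) by simp]
  nth_rewrite 1 [integral_zero]
  refine tendsto_integral_filter_of_dominated_convergence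
    (fun τ => 2 * ∫ r, ‖G (r, τ)‖)
    (Eventually.of_forall fun d => (hsub d).integral_prod_right.1)
    (Eventually.of_forall fun d => ?_) (hG.norm.integral_prod_right.const_mul 2) ?_
  · filter_upwards [hG.prod_left_ae] with τ hτ
    rw [Real.norm_of_nonneg (integral_nonneg fun r => norm_nonneg _)]
    calc ∫ r, ‖G (d + r, τ) - G (r, τ)‖ ≤ ∫ r, (‖G (d + r, τ)‖ + ‖G (r, τ)‖) :=
          integral_mono ((hτ.comp_add_left d).sub hτ).norm
            ((hτ.comp_add_left d).norm.add hτ.norm) fun r => norm_sub_le _ _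
      _ = 2 * ∫ r, ‖G (r, τ)‖ := by
          rw [integral_add (hτ.comp_add_left d).norm hτ.norm,
            integral_add_left_eq_self (fun r => ‖G (r, τ)‖) d]
          ring
  · filter_upwards [hG.prod_left_ae] with τ hτ
    exact tendsto_integral_norm_translate_sub hτ

/-- All regularity comes from the kernel: moving `t` is moved onto `K`, and the change is at most
the `L¹` distance between `c K` and its translate. -/
theorem uniformContinuous_convolution [SFinite μ] {K h : ℝ → X → ℝ} {c : X → ℝ}
    (hc : Integrable (fun p : ℝ × X => c p.2 * K p.1 p.2) (volume.prod μ))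
    (hhc : ∀ r τ, |h r τ| ≤ c τ)
    (hint : ∀ t, Integrable (fun p : ℝ × X => K p.1 p.2 * h (t - p.1) p.2) (volume.prod μ)) :
    UniformContinuous fun t => ∫ p, K p.1 p.2 * h (t - p.1) p.2 ∂(volume.prod μ) := by
  rw [Metric.uniformContinuous_iff]
  intro ε hε
  have hlim := tendsto_integral_norm_translateFst_sub hc
  obtain ⟨δ, hδ, hδ'⟩ := Metric.eventually_nhds_iff.1 (hlim.eventually_lt_const hε)
  refine ⟨δ, hδ, fun {a b} hab => ?_⟩
  have hshift : ∫ p, K p.1 p.2 * h (a - p.1) p.2 ∂(volume.prod μ) =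
      ∫ p : ℝ × X, K (a - b + p.1) p.2 * h (b - p.1) p.2 ∂(volume.prod μ) := by
    rw [← integral_translateFst _ (a - b)]
    congr 1; ext p
    simp only
    rw [show a - (a - b + p.1) = b - p.1 by ring]
  have hint' : Integrable (fun p : ℝ × X => K (a - b + p.1) p.2 * h (b - p.1) p.2)
      (volume.prod μ) := by
    refine (integrable_translateFst (hint a) (a - b)).congr (Eventually.of_forall fun p => ?_)
    simp only
    rw [show a - (a - b + p.1) = b - p.1 by ring]
  rw [Real.dist_eq, hshift, ← integral_sub hint' (hint b)]
  refine lt_of_le_of_lt ?_ (hδ' (y := a - b) (by rwa [Real.dist_0_eq_abs, ← Real.dist_eq]))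
  rw [← Real.norm_eq_abs]
  refine norm_integral_le_of_norm_le ((integrable_translateFst hc (a - b)).sub hc).norm
    (Eventually.of_forall fun p => ?_)
  simp only
  rw [← sub_mul, ← mul_sub, norm_mul, norm_mul, mul_comm]
  gcongr
  rw [Real.norm_eq_abs, Real.norm_eq_abs]
  exact (hhc _ _).trans (le_abs_self _)

end Translation

/-! ### Regularity and compactness of solutions, record minima. -/

section Solutions

variable {X : Type*} [MeasurableSpace X] {μ : Measure X} {K : ℝ → X → ℝ} {g : ℝ → X → ℝ}
  {φ : ℝ → ℝ}

namespace IsSolution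

theorem eq_integral_prod [SFinite μ] (hφ : IsSolution μ K g φ) (t : ℝ) :
    φ t = ∫ p, K p.1 p.2 * g (φ (t - p.1)) p.2 ∂(volume.prod μ) := by
  rw [hφ.equation t, ← integral_prod_symm _ (hφ.integrable t)]

theorem uniformContinuous [SFinite μ] (hφ : IsSolution μ K g φ) (hd : Data μ K g)
    (hC : CondC μ K g) (hb : IsBdd φ) : UniformContinuous φ := by
  obtain ⟨B, hB⟩ := hb
  obtain ⟨C, -, hC0, hCg, hCi⟩ := hC (max B 1) (by positivity)
  rw [show φ = _ from funext hφ.eq_integral_prod]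
  refine uniformContinuous_convolution (h := fun r τ => g (φ r) τ)
    (c := fun τ => C τ * max B 1) ?_ (fun r τ => ?_) hφ.integrable
  · exact (hCi.const_mul (max B 1)).congr (Eventually.of_forall fun p => by simp only; ring)
  · rw [abs_of_nonneg (hd.g_nonneg _ _ (hφ.nonneg r))]
    have hr : φ r ≤ max B 1 := (hB r).trans (le_max_left _ _)
    exact (hCg _ τ ⟨hφ.nonneg r, hr⟩).trans (mul_le_mul_of_nonneg_left hr (hC0 τ))

/-- Truncating `g` at level `k` gives continuous minorants `F k` converging to `φ`. No bound on `φ`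
enters, so this serves for pulses, which are not bounded a priori. -/
theorem lowerSemicontinuous [SFinite μ] (hφ : IsSolution μ K g φ) (hd : Data μ K g) :
    LowerSemicontinuous φ := by
  set F : ℕ → ℝ → ℝ := fun k t =>
    ∫ p, K p.1 p.2 * min (g (φ (t - p.1)) p.2) k ∂(volume.prod μ) with hF
  have hint : ∀ (k : ℕ) t, Integrable
      (fun p : ℝ × X => K p.1 p.2 * min (g (φ (t - p.1)) p.2) k) (volume.prod μ) := by
    intro k t
    refine ((hφ.integrable t).inf (hd.K_integrable.mul_const (k : ℝ))).congr
      (Eventually.of_forall fun p => ?_)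
    exact (mul_min_of_nonneg _ _ (hd.K_nonneg _ _)).symm
  have hcont : ∀ k, Continuous (F k) := fun k =>
    (uniformContinuous_convolution (h := fun r τ => min (g (φ r) τ) k) (c := fun _ => (k : ℝ))
      (hd.K_integrable.const_mul (k : ℝ)) (fun r τ => by
        rw [abs_of_nonneg (le_min (hd.g_nonneg _ _ (hφ.nonneg r)) (Nat.cast_nonneg k))]
        exact min_le_right _ _) (hint k)).continuous
  have hle : ∀ k t, F k t ≤ φ t := by
    intro k t
    rw [hφ.eq_integral_prod t]
    exact integral_mono (hint k t) (hφ.integrable t) fun p =>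
      mul_le_mul_of_nonneg_left (min_le_left _ _) (hd.K_nonneg _ _)
  have hlim : ∀ t, Tendsto (fun k => F k t) atTop (𝓝 (φ t)) := by
    intro t
    rw [hφ.eq_integral_prod t]
    refine tendsto_integral_of_dominated_convergence _ (fun k => (hint k t).1) (hφ.integrable t)
      (fun k => Eventually.of_forall fun p => ?_) (Eventually.of_forall fun p => ?_)
    · have h0 := hd.g_nonneg (φ (t - p.1)) p.2 (hφ.nonneg _)
      rw [Real.norm_of_nonneg
        (mul_nonneg (hd.K_nonneg _ _) (le_min h0 (Nat.cast_nonneg k)))]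
      exact mul_le_mul_of_nonneg_left (min_le_left _ _) (hd.K_nonneg _ _)
    · refine Tendsto.const_mul _ (tendsto_const_nhds.congr' ?_)
      filter_upwards [tendsto_natCast_atTop_atTop.eventually_ge_atTop (g (φ (t - p.1)) p.2)]
        with k hk
      rw [min_eq_left hk]
  intro t y hy
  obtain ⟨k, hk⟩ := ((hlim t).eventually_const_lt hy).exists
  filter_upwards [(hcont k).continuousAt.eventually_const_lt hk] with s hs
  exact hs.trans_le (hle k s)

/-- Pointwise limits of translates of a bounded solution are bounded solutions. -/
theorem of_tendsto_translate [SFinite μ] (hφ : IsSolution μ K g φ) (hd : Data μ K g)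
    (hC : CondC μ K g) {B : ℝ} (hB : ∀ t, φ t ≤ B) {T : ℕ → ℝ} {ψ : ℝ → ℝ}
    (hψ : ∀ t, Tendsto (fun n => φ (t + T n)) atTop (𝓝 (ψ t))) : IsSolution μ K g ψ := by
  obtain ⟨C, -, hC0, hCg, hCi⟩ := hC (max B 1) (by positivity)
  have hψ0 : ∀ t, 0 ≤ ψ t := fun t => ge_of_tendsto' (hψ t) fun n => hφ.nonneg _
  set F : ℝ → ℕ → ℝ × X → ℝ := fun t n p => K p.1 p.2 * g (φ (t + T n - p.1)) p.2 with hF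
  have hFm : ∀ t n, AEStronglyMeasurable (F t n) (volume.prod μ) := fun t n =>
    (hφ.integrable (t + T n)).1
  have hFlim : ∀ t p, Tendsto (fun n => F t n p) atTop
      (𝓝 (K p.1 p.2 * g (ψ (t - p.1)) p.2)) := by
    intro t p
    have h1 : Tendsto (fun n => φ (t + T n - p.1)) atTop (𝓝[Ici 0] (ψ (t - p.1))) := by
      refine tendsto_nhdsWithin_iff.2 ⟨?_, Eventually.of_forall fun n => hφ.nonneg _⟩
      refine (hψ (t - p.1)).congr fun n => ?_
      congr 1; ring
    exact (((hd.g_continuous p.2) _ (hψ0 _)).tendsto.comp h1).const_mul _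
  have hbound : ∀ t n p, ‖F t n p‖ ≤ max B 1 * (C p.2 * K p.1 p.2) := by
    intro t n p
    have h0 := hφ.nonneg (t + T n - p.1)
    have h1 : φ (t + T n - p.1) ≤ max B 1 := (hB _).trans (le_max_left _ _)
    rw [Real.norm_of_nonneg (mul_nonneg (hd.K_nonneg _ _) (hd.g_nonneg _ _ h0))]
    calc K p.1 p.2 * g (φ (t + T n - p.1)) p.2 ≤ K p.1 p.2 * (C p.2 * max B 1) :=
          mul_le_mul_of_nonneg_left ((hCg _ p.2 ⟨h0, h1⟩).trans
            (mul_le_mul_of_nonneg_left h1 (hC0 _))) (hd.K_nonneg _ _)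
      _ = _ := by ring
  have hint : ∀ t, Integrable (fun p : ℝ × X => K p.1 p.2 * g (ψ (t - p.1)) p.2)
      (volume.prod μ) := fun t =>
    (hCi.const_mul (max B 1)).mono'
      (aestronglyMeasurable_of_tendsto_ae atTop (hFm t) (Eventually.of_forall (hFlim t)))
      (Eventually.of_forall fun p =>
        le_of_tendsto' (hFlim t p).norm fun n => hbound t n p)
  refine ⟨measurable_of_tendsto_metrizable (f := fun n t => φ (t + T n))
    (fun n => hφ.measurable.comp (measurable_id.add_const _)) (tendsto_pi_nhds.2 hψ),
    hψ0, hint, fun t => ?_⟩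
  rw [← integral_prod_symm _ (hint t)]
  refine tendsto_nhds_unique (hψ t) ?_
  refine Tendsto.congr (fun n => (hφ.eq_integral_prod (t + T n)).symm) ?_
  exact tendsto_integral_of_dominated_convergence _ (hFm t) (hCi.const_mul (max B 1))
    (fun n => Eventually.of_forall (hbound t n)) (Eventually.of_forall (hFlim t))

end IsSolution

/-- The translates of a bounded uniformly continuous function have a pointwise convergent
subsequence. -/
theorem exists_tendsto_translate (hu : UniformContinuous φ) {B : ℝ} (h0 : ∀ t, 0 ≤ φ t)
    (hB : ∀ t, φ t ≤ B) (T : ℕ → ℝ) :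
    ∃ k : ℕ → ℕ, StrictMono k ∧ ∃ ψ : ℝ → ℝ,
      ∀ t, Tendsto (fun n => φ (t + T (k n))) atTop (𝓝 (ψ t)) := by
  -- Compactness of `[0, B]^ℚ` gives convergence at rational points; uniform continuity extends it
  -- to all `t`.
  obtain ⟨x, k, hk, hx⟩ := CompactSpace.tendsto_subseq
    fun n => fun q : ℚ => (⟨φ (q + T n), h0 _, hB _⟩ : Icc (0 : ℝ) B)
  refine ⟨k, hk, ?_⟩
  have hq : ∀ q : ℚ, CauchySeq fun n => φ (q + T (k n)) := fun q =>
    ((continuous_subtype_val.tendsto _).comp (tendsto_pi_nhds.1 hx q)).cauchySeq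
  have hc : ∀ t : ℝ, CauchySeq fun n => φ (t + T (k n)) := by
    intro t
    rw [Metric.cauchySeq_iff]
    intro ε hε
    obtain ⟨δ, hδ, hδ'⟩ := Metric.uniformContinuous_iff.1 hu (ε / 3) (by positivity)
    obtain ⟨q, hq1, hq2⟩ := exists_rat_btwn (show t < t + δ by linarith)
    obtain ⟨N, hN⟩ := Metric.cauchySeq_iff.1 (hq q) (ε / 3) (by positivity)
    have hclose : ∀ n, dist (φ (t + T (k n))) (φ (q + T (k n))) < ε / 3 := fun n => hδ' (by
      rw [dist_add_right, Real.dist_eq, abs_lt]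
      constructor <;> linarith)
    refine ⟨N, fun m hm n hn => ?_⟩
    have h1 := hclose m
    have h2 := hN m hm n hn
    have h3 := hclose n
    rw [dist_comm] at h3
    linarith [dist_triangle4 (φ (t + T (k m))) (φ (q + T (k m))) (φ (q + T (k n)))
      (φ (t + T (k n)))]
  choose ψ hψ using fun t => cauchySeq_tendsto_of_complete (hc t)
  exact ⟨ψ, hψ⟩

/-- A positive lower semicontinuous function with infimum zero on `(-∞, 0]` has record
minima along a sequence going to `-∞`. -/
theorem exists_seq_record_minima (hl : LowerSemicontinuous φ) (hpos : ∀ t, 0 < φ t)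
    (hsmall : ∀ c > 0, ∃ t ≤ 0, φ t < c) :
    ∃ T : ℕ → ℝ, Tendsto T atTop atBot ∧ Tendsto (fun n => φ (T n)) atTop (𝓝 0) ∧
      ∀ t, 0 ≤ t → ∀ᶠ n in atTop, φ (T n) ≤ φ (t + T n) := by
  have hmin : ∀ b : ℝ, 0 ≤ b → ∃ a ∈ Icc (-b) 0, IsMinOn φ (Icc (-b) 0) a := fun b hb =>
    (hl.lowerSemicontinuousOn _).exists_isMinOn ⟨0, by simpa using hb⟩ isCompact_Icc
  choose T hT hTmin using fun n : ℕ => hmin n (Nat.cast_nonneg n)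
  have hlim : Tendsto (fun n => φ (T n)) atTop (𝓝 0) := by
    rw [Metric.tendsto_atTop]
    intro ε hε
    obtain ⟨t, ht0, ht⟩ := hsmall ε hε
    obtain ⟨N, hN⟩ := exists_nat_ge (-t)
    refine ⟨N, fun n hn => ?_⟩
    have hn' : (N : ℝ) ≤ n := by exact_mod_cast hn
    rw [Real.dist_0_eq_abs, abs_of_pos (hpos _)]
    exact (isMinOn_iff.1 (hTmin n) t ⟨by linarith, ht0⟩).trans_lt ht
  have hbot : Tendsto T atTop atBot := by
    rw [tendsto_atBot]
    intro b
    -- The minimum over `[-|b|, 0]` is positive, so `φ (T n)` eventually drops below it and `T n`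
    -- leaves that interval.
    obtain ⟨a, ha, hamin⟩ := hmin |b| (abs_nonneg b)
    filter_upwards [hlim.eventually_lt_const (hpos a)] with n hn
    by_contra! hb
    refine absurd (isMinOn_iff.1 hamin (T n) ⟨?_, (hT n).2⟩) (not_le.2 hn)
    linarith [neg_abs_le b]
  refine ⟨T, hbot, hlim, fun t ht => ?_⟩
  filter_upwards [hbot.eventually_le_atBot (-t)] with n hn
  exact isMinOn_iff.1 (hTmin n) _ ⟨by linarith [(hT n).1], by linarith⟩

theorem exists_char_nonneg_of_bounded [SFinite μ] (hd : Data μ K g) (hC : CondC μ K g)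
    (hP : CondP μ K g) (h : CharDefined μ K g 0) (hneg : char μ K g 0 < 0)
    (hφ : IsSolution μ K g φ) (hb : IsBdd φ) (hpos : ∀ t, 0 < φ t)
    (hlim : ¬ 0 < liminf φ atBot) :
    ∃ z : ℝ, 0 < z ∧ CharDefined μ K g z ∧ 0 ≤ char μ K g z := by
  obtain ⟨B, hB⟩ := hb
  have hsmall : ∀ c > 0, ∃ t ≤ 0, φ t < c := by
    by_contra! hc
    obtain ⟨c, hc0, hc⟩ := hc
    refine hlim (hc0.trans_le (le_liminf_of_le ?_ ?_))
    · exact (isBoundedUnder_of ⟨B, hB⟩ : IsBoundedUnder (· ≤ ·) atBot φ).isCoboundedUnder_ge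
    · filter_upwards [eventually_le_atBot 0] with t ht using hc t ht
  obtain ⟨T, -, hT0, hTmin⟩ :=
    exists_seq_record_minima (hφ.lowerSemicontinuous hd) hpos hsmall
  obtain ⟨k, hk, ψ, hψ⟩ :=
    exists_tendsto_translate (hφ.uniformContinuous hd hC ⟨B, hB⟩) hφ.nonneg hB T
  have hψ0 : ψ 0 = 0 := by
    refine tendsto_nhds_unique (hψ 0) ?_
    simp only [zero_add]
    exact hT0.comp hk.tendsto_atTop
  have hzero := hP ψ (hφ.of_tendsto_translate hd hC hB hψ)
    ⟨B, fun t => le_of_tendsto' (hψ t) fun n => hB _⟩ ⟨0, hψ0⟩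
  refine exists_char_nonneg hd h hneg hφ hpos (T := T ∘ k) (fun t => ?_) fun t ht =>
    hk.tendsto_atTop.eventually (hTmin t ht)
  have := hψ t
  rwa [hzero t] at this

/-- Decay at `-∞` makes the translates vanish in the limit directly, replacing compactness and (P).
-/
theorem exists_char_nonneg_of_tendsto [SFinite μ] (hd : Data μ K g)
    (h : CharDefined μ K g 0) (hneg : char μ K g 0 < 0)
    (hφ : IsSolution μ K g φ) (hpos : ∀ t, 0 < φ t) (hlim : Tendsto φ atBot (𝓝 0)) :
    ∃ z : ℝ, 0 < z ∧ CharDefined μ K g z ∧ 0 ≤ char μ K g z := by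
  obtain ⟨T, hT, -, hTmin⟩ := exists_seq_record_minima (hφ.lowerSemicontinuous hd) hpos
    fun c hc => ((eventually_le_atBot 0).and (hlim.eventually_lt_const hc)).exists
  exact exists_char_nonneg hd h hneg hφ hpos
    (fun t => hlim.comp (tendsto_atBot_add_const_left atTop t hT)) hTmin

/-! ### Reflection `s ↦ -s`, exchanging `-∞` with `+∞` and `χ(z)` with `χ(-z)`. -/

section Reflection

/-- The kernel reflected in its first variable. -/
def reflect (K : ℝ → X → ℝ) (s : ℝ) (τ : X) : ℝ := K (-s) τ

/-- Reflection of the first coordinate of `ℝ × X`. -/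
def negFst (X : Type*) [MeasurableSpace X] : ℝ × X ≃ᵐ ℝ × X :=
  (MeasurableEquiv.neg ℝ).prodCongr (MeasurableEquiv.refl X)

theorem measurePreserving_negFst [SFinite μ] :
    MeasurePreserving (negFst X) (volume.prod μ) (volume.prod μ) :=
  (Measure.measurePreserving_neg volume).prod (MeasurePreserving.id μ)

theorem integrable_negFst [SFinite μ] {G : ℝ × X → ℝ} :
    Integrable (fun p => G (-p.1, p.2)) (volume.prod μ) ↔ Integrable G (volume.prod μ) :=
  measurePreserving_negFst.integrable_comp_emb (negFst X).measurableEmbedding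

theorem integral_negFst [SFinite μ] (G : ℝ × X → ℝ) :
    ∫ p, G (-p.1, p.2) ∂(volume.prod μ) = ∫ p, G p ∂(volume.prod μ) :=
  measurePreserving_negFst.integral_comp' G

theorem Data.reflect [SFinite μ] (hd : Data μ K g) : Data μ (reflect K) g where
  K_nonneg s τ := hd.K_nonneg _ _
  K_integrable := integrable_negFst.2 hd.K_integrable
  K_pos τ := by
    have := hd.K_pos τ
    rwa [← lintegral_neg_eq_self] at this
  g_nonneg := hd.g_nonneg
  g_measurable := hd.g_measurable
  g_zero := hd.g_zero
  g_continuous := hd.g_continuous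
  g_differentiable := hd.g_differentiable
  g_slope_pos := hd.g_slope_pos

theorem CondC.reflect [SFinite μ] (hC : CondC μ K g) : CondC μ (reflect K) g := by
  intro δ hδ
  obtain ⟨C, hCm, hC0, hCg, hCi⟩ := hC δ hδ
  exact ⟨C, hCm, hC0, hCg, integrable_negFst.2 hCi⟩

theorem IsSolution.reflect [SFinite μ] (hφ : IsSolution μ K g φ) :
    IsSolution μ (reflect K) g fun t => φ (-t) where
  measurable := hφ.measurable.comp measurable_neg
  nonneg t := hφ.nonneg _
  integrable t := by
    refine (integrable_negFst.2 (hφ.integrable (-t))).congr (Eventually.of_forall fun p => ?_)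
    simp only [ConvEq.reflect]
    congr 3; ring
  equation t := by
    rw [hφ.equation]
    congr 1; ext τ
    rw [← integral_neg_eq_self]
    congr 1; ext s
    simp only [ConvEq.reflect]
    congr 3; ring

theorem reflect_reflect {Y : Type*} (K : ℝ → Y → ℝ) : reflect (reflect K) = K := by
  ext s τ; simp [reflect]

theorem CondP.reflect [SFinite μ] (hP : CondP μ K g) : CondP μ (reflect K) g := by
  rintro φ hφ ⟨B, hB⟩ ⟨t, ht⟩ s
  have h := hφ.reflect
  rw [reflect_reflect] at h
  simpa using hP _ h ⟨B, fun t => hB _⟩ ⟨-t, by simpa using ht⟩ (-s)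

theorem charIntegrand_reflect {Y : Type*} (K g : ℝ → Y → ℝ) (z : ℝ) :
    charIntegrand (reflect K) g z = fun p => charIntegrand K g (-z) (-p.1, p.2) := by
  ext p; simp [charIntegrand, reflect]

theorem charDefined_reflect [SFinite μ] {z : ℝ} :
    CharDefined μ (reflect K) g z ↔ CharDefined μ K g (-z) := by
  rw [CharDefined, charIntegrand_reflect]
  exact integrable_negFst

theorem char_reflect [SFinite μ] (z : ℝ) : char μ (reflect K) g z = char μ K g (-z) := by
  rw [char, char, charIntegrand_reflect, integral_negFst]

end Reflection

end Solutions

end ConvEq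

end

theorem mainTheorem7 {X : Type*} [MeasurableSpace X] (μ : MeasureTheory.Measure X)
    [MeasureTheory.IsFiniteMeasure μ] (K : ℝ → X → ℝ) (g : ℝ → X → ℝ)
    (hdata : ConvEq.Data μ K g) (hC : ConvEq.CondC μ K g) (hP : ConvEq.CondP μ K g)
    (hdef : ConvEq.CharDefined μ K g 0) (hneg : ConvEq.char μ K g 0 < 0) :
    ((¬ ∃ z : ℝ, 0 < z ∧ ConvEq.IsCharZero μ K g z) →
      ∀ φ : ℝ → ℝ, ConvEq.IsSolution μ K g φ → ConvEq.IsBdd φ → (∀ t, 0 < φ t) →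
        0 < Filter.liminf φ Filter.atBot) ∧
    ((¬ ∃ z : ℝ, z < 0 ∧ ConvEq.IsCharZero μ K g z) →
      ∀ φ : ℝ → ℝ, ConvEq.IsSolution μ K g φ → ConvEq.IsBdd φ → (∀ t, 0 < φ t) →
        0 < Filter.liminf φ Filter.atTop) ∧
    (¬ ∃ φ : ℝ → ℝ, ConvEq.IsPositivePulse μ K g φ) := by
  have hdef' : ConvEq.CharDefined μ (ConvEq.reflect K) g 0 :=
    ConvEq.charDefined_reflect.2 (by rwa [neg_zero])
  have hneg' : ConvEq.char μ (ConvEq.reflect K) g 0 < 0 := by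
    rwa [ConvEq.char_reflect, neg_zero]
  refine ⟨fun hno φ hφ hb hpos => ?_, fun hno φ hφ hb hpos => ?_, ?_⟩
  · by_contra hlim
    obtain ⟨z, hz, hzd, hz0⟩ :=
      ConvEq.exists_char_nonneg_of_bounded hdata hC hP hdef hneg hφ hb hpos hlim
    obtain ⟨l, hl, hzero⟩ := ConvEq.exists_isCharZero_of_char_nonneg hdata hdef hneg hzd hz0
    exact hno ⟨_, mul_pos hl hz, hzero⟩
  · by_contra hlim
    obtain ⟨B, hB⟩ := hb
    have hmap : Filter.liminf (fun t => φ (-t)) Filter.atBot = Filter.liminf φ Filter.atTop := by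
      rw [← Filter.map_neg_atBot, Filter.liminf, Filter.liminf, Filter.map_map]
      rfl
    obtain ⟨z, hz, hzd, hz0⟩ :=
      ConvEq.exists_char_nonneg_of_bounded hdata.reflect hC.reflect hP.reflect hdef' hneg'
        hφ.reflect ⟨B, fun t => hB _⟩ (fun t => hpos _) (by rwa [hmap])
    rw [ConvEq.charDefined_reflect] at hzd
    rw [ConvEq.char_reflect] at hz0
    obtain ⟨l, hl, hzero⟩ := ConvEq.exists_isCharZero_of_char_nonneg hdata hdef hneg hzd hz0
    exact hno ⟨_, mul_neg_of_pos_of_neg hl (neg_lt_zero.2 hz), hzero⟩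
  · rintro ⟨φ, hφ, hpos, hbot, htop⟩
    obtain ⟨z, hz, hzd, hz0⟩ :=
      ConvEq.exists_char_nonneg_of_tendsto hdata hdef hneg hφ hpos hbot
    obtain ⟨w, hw, hwd, hw0⟩ :=
      ConvEq.exists_char_nonneg_of_tendsto hdata.reflect hdef' hneg' hφ.reflect
        (fun t => hpos _) (htop.comp Filter.tendsto_neg_atBot_atTop)
    rw [ConvEq.charDefined_reflect] at hwd
    rw [ConvEq.char_reflect] at hw0
    exact ConvEq.not_char_nonneg_both hdata hdef hneg hz (neg_lt_zero.2 hw) hzd hwd hz0 hw0
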